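/- Let $K$ be a field, let $G$ be a finite simple graph that is a tree, with vertex set $\{1,\dots,n\}$ ($n\ge 1$), and let $G^*$ be its whisker graph, i.e. the graph on $\{1,\dots,n\}\cup\{1',\dots,n'\}$ with edge set $E(G)\cup\{\{1,1'\},\dots,\{n,n'\}\}$. Let $S^*=K[x_1,\dots,x_n,y_1,\dots,y_n]$ and let $$I(G^*)=\bigl(x_ix_j : \{i,j\}\in E(G)\bigr)+\bigl(x_iy_i : 1\le i\le n\bigr)\subset S^*$$ be the edge ideal of $G^*$. Then $$\operatorname{depth}\bigl(S^*/I(G^*)^k\bigr)=n-k+1\qquad\text{for } k=1,\dots,n,$$ where $\operatorname{depth}$ is the maximal length of a regular sequence on the $S^*$-module $S^*/I(G^*)^k$ consisting of elements of the ideal $(x_1,\dots,x_n,y_1,\dots,y_n)$. -/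

import Mathlib

/-- The edge ideal of a graph `G` over `K`: the ideal of `K[x_v : v ∈ V]` generated by the monomials
`x_u x_v` with `{u, v}` an edge of `G`. -/
noncomputable def edgeIdeal (K : Type*) [Field K] {V : Type*} (G : SimpleGraph V) :
    Ideal (MvPolynomial V K) :=
  Ideal.span {f | ∃ u v : V, G.Adj u v ∧ f = MvPolynomial.X u * MvPolynomial.X v}

/-- The whisker graph of `G`: the vertex `v` of `G` is `Sum.inl v`, the new leaf attached to it is
`Sum.inr v`. -/
def whiskerGraph {V : Type*} (G : SimpleGraph V) : SimpleGraph (V ⊕ V) where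
  Adj
    | Sum.inl u, Sum.inl v => G.Adj u v
    | Sum.inl u, Sum.inr v => u = v
    | Sum.inr u, Sum.inl v => u = v
    | Sum.inr _, Sum.inr _ => False
  symm := ⟨by
    rintro (u | u) (v | v) h
    · exact G.symm.symm _ _ h
    · exact Eq.symm h
    · exact Eq.symm h
    · exact h⟩
  loopless := ⟨by
    rintro (u | u) h
    · exact G.loopless.irrefl u h
    · exact h⟩

/-- The depth of a module `M` with respect to an ideal `I`: the supremum of the lengths of the
`M`-regular sequences with entries in `I`. -/
noncomputable def depthAt {R : Type*} [CommRing R] (I : Ideal R) (M : Type*) [AddCommGroup M]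
    [Module R M] : ℕ∞ :=
  sSup {d : ℕ∞ | ∃ rs : List R, (∀ r ∈ rs, r ∈ I) ∧ RingTheory.Sequence.IsRegular M rs ∧
    d = (rs.length : ℕ∞)}

/-! Depth is read off from the vanishing of `Ext^i(R ⧸ I, M)`, by Rees's theorem.

Lower bound (`IsPacking.extVanishesBelow`). For any forest, if `T` is a set of vertices of `G - W`
at pairwise distance at least three, then the quotient by `(X_w : w ∈ W) + I(G)^k` has depth at
least `|T| + 1 - k`. The proof is an induction on `k` and on the number of vertices outside `W`.
Pick `v` in `G - W` with a leaf neighbour and at most one non-leaf neighbour, and apply the depth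
lemma to the colon by `X_v`. Adding `X_v` deletes `v`. The colon by `X_v` is resolved by treating
the neighbours `x` of `v` in turn: a further colon by `X_x` lowers the power by one, while adding
`X_x` deletes `x`. A packing loses at most one vertex where the power drops, and none otherwise. The
`n` whisker leaves form a packing, which gives `n - k + 1`.

Upper bound. For the power `k + 1` take a connected set `H` of `k + 1` vertices, the product `f` of
the `k` edges of a spanning tree of `H` (`exists_isReroutable`), and `w = f * ∏ y_j` over `j ∉ H`. A
2-colouring splits the variables on and above `H` into two classes. A product of variables from
different classes kills `w` modulo `I^(k+1)` (`IsReroutable.add_mem`), a single one does not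
(`IsReroutable.single_add_notMem`), and each `x_j` with `j ∉ H` kills `w`. So the annihilator of `w`
contains an intersection of two ideals of variables whose sum `P` omits only the `n - k - 1`
variables `y_j`, `j ∉ H`. This gives a map `P → M` with no extension to the ring near the origin, so
`Ext^1(R ⧸ P, M)` survives there (`not_killed_ext_one`). A depth above `1 + (n - k - 1)` would force
it to vanish locally (`ExtVanishesBelow.killed`). -/

open MvPolynomial CategoryTheory Abelian

universe u

/-! ### Depth through Ext, with elements of `1 + I` in place of localisation. -/

section ExtDepth

variable {R : Type u} [CommRing R]

/-- The modules `Ext^i(R ⧸ I, M)` vanish for `i < d`. -/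
def ExtVanishesBelow (I : Ideal R) (M : Type u) [AddCommGroup M] [Module R M] (d : ℕ) : Prop :=
  ∀ i < d, Subsingleton (Ext (ModuleCat.of R (R ⧸ I)) (ModuleCat.of R M) i)

/-- The module `N` is killed by an element of `1 + I`. -/
def KilledByOneAdd (I : Ideal R) (N : Type*) [AddCommGroup N] [Module R N] : Prop :=
  ∃ s : R, s - 1 ∈ I ∧ ∀ e : N, s • e = 0

/-- The map `R ⧸ J₁ → R ⧸ J` induced by multiplication by `f`. -/
def quotMul (J₁ J : Ideal R) (f : R) (h : ∀ a ∈ J₁, f * a ∈ J) : (R ⧸ J₁) →ₗ[R] (R ⧸ J) :=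
  Submodule.mapQ J₁ J (LinearMap.lsmul R R f) h

lemma quotMul_mk (J₁ J : Ideal R) (f : R) (h : ∀ a ∈ J₁, f * a ∈ J) (a : R) :
    quotMul J₁ J f h (Submodule.Quotient.mk a) = Submodule.Quotient.mk (f * a) := rfl

lemma exact_quotMul_factor {J₁ J J₂ : Ideal R} {f : R} (h₁ : ∀ a, a ∈ J₁ ↔ f * a ∈ J)
    (h₂ : J₂ = J ⊔ Ideal.span {f}) :
    Function.Exact (quotMul J₁ J f fun a ha => (h₁ a).1 ha)
      (Submodule.factor (show J ≤ J₂ from h₂ ▸ le_sup_left)) := by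
  intro x
  obtain ⟨a, rfl⟩ := Submodule.Quotient.mk_surjective _ x
  have h0 : (Submodule.factor (show J ≤ J₂ from h₂ ▸ le_sup_left)) (Submodule.Quotient.mk a)
    = Submodule.Quotient.mk a := rfl
  rw [h0, Submodule.Quotient.mk_eq_zero, h₂]
  constructor
  · intro ha
    obtain ⟨b, hb, c, hc, rfl⟩ := Submodule.mem_sup.1 ha
    obtain ⟨e, rfl⟩ := Ideal.mem_span_singleton'.1 hc
    refine ⟨Submodule.Quotient.mk e, ?_⟩
    rw [quotMul_mk, Submodule.Quotient.eq]
    have : f * e - (b + e * f) = -b := by ring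
    rw [this]
    exact J.neg_mem hb
  · rintro ⟨y, hy⟩
    obtain ⟨e, rfl⟩ := Submodule.Quotient.mk_surjective _ y
    rw [quotMul_mk, Submodule.Quotient.eq] at hy
    have : a = -(f * e - a) + e * f := by ring
    rw [this]
    exact Submodule.add_mem_sup (J.neg_mem hy) (Ideal.mem_span_singleton'.2 ⟨e, rfl⟩)

lemma injective_quotMul {J₁ J : Ideal R} {f : R} (h₁ : ∀ a, a ∈ J₁ ↔ f * a ∈ J) :
    Function.Injective (quotMul J₁ J f fun a ha => (h₁ a).1 ha) := by
  rw [injective_iff_map_eq_zero]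
  intro x hx
  obtain ⟨a, rfl⟩ := Submodule.Quotient.mk_surjective _ x
  rw [quotMul_mk, Submodule.Quotient.mk_eq_zero] at hx
  exact (Submodule.Quotient.mk_eq_zero _).2 ((h₁ a).2 hx)

/-- The complex `R ⧸ (J : f) → R ⧸ J → R ⧸ (J, f)`. -/
abbrev colonShortComplex {J₁ J J₂ : Ideal R} {f : R} (h₁ : ∀ a, a ∈ J₁ ↔ f * a ∈ J)
    (h₂ : J₂ = J ⊔ Ideal.span {f}) : ShortComplex (ModuleCat.{u} R) where
  X₁ := ModuleCat.of R (R ⧸ J₁)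
  X₂ := ModuleCat.of R (R ⧸ J)
  X₃ := ModuleCat.of R (R ⧸ J₂)
  f := ModuleCat.ofHom (quotMul J₁ J f fun a ha => (h₁ a).1 ha)
  g := ModuleCat.ofHom (Submodule.factor (show J ≤ J₂ from h₂ ▸ le_sup_left))
  zero := ModuleCat.hom_ext (exact_quotMul_factor h₁ h₂).linearMap_comp_eq_zero

lemma colonShortComplex_shortExact {J₁ J J₂ : Ideal R} {f : R} (h₁ : ∀ a, a ∈ J₁ ↔ f * a ∈ J)
    (h₂ : J₂ = J ⊔ Ideal.span {f}) : (colonShortComplex h₁ h₂).ShortExact where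
  exact := ModuleCat.shortComplex_exact _ (exact_quotMul_factor h₁ h₂)
  mono_f := (ModuleCat.mono_iff_injective _).2 (injective_quotMul h₁)
  epi_g := (ModuleCat.epi_iff_surjective _).2
    (Submodule.factor_surjective (show J ≤ J₂ from h₂ ▸ le_sup_left))

lemma ExtVanishesBelow.mono {I : Ideal R} {M : Type u} [AddCommGroup M] [Module R M] {d e : ℕ}
    (h : ExtVanishesBelow I M e) (hde : d ≤ e) : ExtVanishesBelow I M d :=
  fun i hi => h i (hi.trans_le hde)

lemma extVanishesBelow_of_subsingleton (I : Ideal R) (M : Type u) [AddCommGroup M] [Module R M]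
    [Subsingleton M] (d : ℕ) : ExtVanishesBelow I M d := fun i _ => by
  have h0 : 𝟙 (ModuleCat.of R M) = 0 :=
    (ModuleCat.isZero_of_subsingleton (ModuleCat.of R M)).eq_of_src _ _
  refine subsingleton_of_forall_eq 0 fun x => ?_
  rw [← Ext.comp_mk₀_id x, h0, Ext.mk₀_zero, Ext.comp_zero]

/-- The depth lemma for `0 → R ⧸ (J : f) → R ⧸ J → R ⧸ (J, f) → 0`. -/
lemma ExtVanishesBelow.of_colon {I J₁ J J₂ : Ideal R} {f : R} {d : ℕ}
    (h₁ : ∀ a, a ∈ J₁ ↔ f * a ∈ J) (h₂ : J₂ = J ⊔ Ideal.span {f})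
    (hJ₁ : ExtVanishesBelow I (R ⧸ J₁) d) (hJ₂ : ExtVanishesBelow I (R ⧸ J₂) d) :
    ExtVanishesBelow I (R ⧸ J) d := fun i hi => by
  have := hJ₁ i hi
  have := hJ₂ i hi
  refine subsingleton_of_forall_eq 0 fun x => ?_
  obtain ⟨y, hy⟩ := Ext.covariant_sequence_exact₂ (ModuleCat.of R (R ⧸ I))
    (colonShortComplex_shortExact h₁ h₂) (n := i) x (Subsingleton.elim (α := Ext
      (ModuleCat.of R (R ⧸ I)) (ModuleCat.of R (R ⧸ J₂)) i) _ _)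
  rw [← hy, Subsingleton.elim (α := Ext (ModuleCat.of R (R ⧸ I)) (ModuleCat.of R (R ⧸ J₁)) i) y 0]
  exact Ext.zero_comp ..

lemma colonShortComplex_f {J J₂ : Ideal R} {f : R} (h₁ : ∀ a, a ∈ J ↔ f * a ∈ J)
    (h₂ : J₂ = J ⊔ Ideal.span {f}) :
    (colonShortComplex h₁ h₂).f = f • 𝟙 (ModuleCat.of R (R ⧸ J)) := by
  refine ModuleCat.hom_ext (LinearMap.ext fun x => ?_)
  obtain ⟨a, rfl⟩ := Submodule.Quotient.mk_surjective _ x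
  rfl

lemma ext_smul_eq_zero_of_mem {I : Ideal R} {f : R} (hf : f ∈ I) {M : ModuleCat.{u} R} {i : ℕ}
    (x : Ext (ModuleCat.of R (R ⧸ I)) M i) : f • x = 0 := by
  have h0 : f • 𝟙 (ModuleCat.of R (R ⧸ I)) = 0 := by
    refine ModuleCat.hom_ext (LinearMap.ext fun x => ?_)
    obtain ⟨a, rfl⟩ := Submodule.Quotient.mk_surjective _ x
    exact (Submodule.Quotient.mk_eq_zero _).2 (I.mul_mem_right a hf)
  rw [← Ext.mk₀_id_comp x, ← Ext.smul_comp, ← Ext.mk₀_smul, h0, Ext.mk₀_zero, Ext.zero_comp]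

/-- Depth rises by one along a nonzerodivisor of `R ⧸ J`. -/
lemma ExtVanishesBelow.succ {I J J₂ : Ideal R} {f : R} {d : ℕ} (hf : f ∈ I)
    (h₁ : ∀ a, a ∈ J ↔ f * a ∈ J) (h₂ : J₂ = J ⊔ Ideal.span {f})
    (hJ₂ : ExtVanishesBelow I (R ⧸ J₂) d) : ExtVanishesBelow I (R ⧸ J) (d + 1) := fun i hi => by
  -- Multiplication by `f` acts as zero on these Ext groups because `f ∈ I` kills `R ⧸ I`.
  have key : ∀ x : Ext (ModuleCat.of R (R ⧸ I)) (ModuleCat.of R (R ⧸ J)) i,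
      x.comp (Ext.mk₀ (colonShortComplex h₁ h₂).f) (add_zero i) = 0 := fun x => by
    have : x.comp (Ext.mk₀ (f • 𝟙 (ModuleCat.of R (R ⧸ J)))) (add_zero i) = 0 := by
      rw [← Ext.smul_eq_comp_mk₀]
      exact ext_smul_eq_zero_of_mem hf x
    rw [colonShortComplex_f]
    exact this
  refine subsingleton_of_forall_eq 0 fun x => ?_
  cases i with
  | zero =>
    have hm := (colonShortComplex_shortExact h₁ h₂).mono_f
    refine Ext.postcomp_mk₀_injective_of_mono (ModuleCat.of R (R ⧸ I))
      (colonShortComplex h₁ h₂).f ?_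
    rw [map_zero]
    exact key x
  | succ j =>
    have := hJ₂ j (by omega)
    obtain ⟨y, hy⟩ := Ext.covariant_sequence_exact₁ (ModuleCat.of R (R ⧸ I))
      (colonShortComplex_shortExact h₁ h₂) x (key x) rfl
    rw [← hy, Subsingleton.elim (α := Ext (ModuleCat.of R (R ⧸ I)) (ModuleCat.of R (R ⧸ J₂)) j) y 0]
    exact Ext.zero_comp ..

/-- If `y ∈ I` is a nonzerodivisor of `R ⧸ J`, then `Ext^i(R ⧸ J, M)` vanishes near `V(I)` as soon
as `Ext^(i+1)(R ⧸ (J, y), M)` does. -/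
lemma KilledByOneAdd.of_succ [IsNoetherianRing R] {I J J₂ : Ideal R} {y : R} (hy : y ∈ I)
    (h₁ : ∀ a, a ∈ J ↔ y * a ∈ J) (h₂ : J₂ = J ⊔ Ideal.span {y})
    (M : ModuleCat.{u} R) [Module.Finite R M] {i : ℕ}
    (h : KilledByOneAdd I (Ext (ModuleCat.of R (R ⧸ J₂)) M (i + 1))) :
    KilledByOneAdd I (Ext (ModuleCat.of R (R ⧸ J)) M i) := by
  obtain ⟨s, hs, h⟩ := h
  -- Write `E` for this Ext module. The long exact sequence gives `s E ⊆ y E`, and `s - 1 ∈ I`, so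
  -- `E = I E` and Nakayama's lemma applies.
  have hle : (⊤ : Submodule R (Ext (ModuleCat.of R (R ⧸ J)) M i)) ≤ I • ⊤ := by
    intro e _
    obtain ⟨x, hx⟩ := Ext.contravariant_sequence_exact₁ (colonShortComplex_shortExact h₁ h₂) M
      (s • e) (add_comm 1 i) (by
        rw [Ext.comp_smul]
        exact h _)
    have hyx : y • x = s • e := by
      rw [← hx, colonShortComplex_f, Ext.mk₀_smul, Ext.smul_comp]
      congr 1
      exact (Ext.mk₀_id_comp x).symm
    have he : e = y • x - (s - 1) • e := by rw [hyx, sub_smul, one_smul]; abel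
    rw [he]
    exact Submodule.sub_mem _ (Submodule.smul_mem_smul hy trivial)
      (Submodule.smul_mem_smul hs trivial)
  obtain ⟨r, hr, hr0⟩ := Submodule.exists_sub_one_mem_and_smul_eq_zero_of_fg_of_le_smul I ⊤
    Module.Finite.fg_top hle
  exact ⟨r, hr, fun e => hr0 e trivial⟩

/-- A linear map `P → M` extends to `R`, up to a factor in `1 + I`, if `Ext^1(R ⧸ P, M)` is killed
by such a factor. -/
lemma KilledByOneAdd.exists_extension {I P : Ideal R} {M : Type u} [AddCommGroup M] [Module R M]
    (h : KilledByOneAdd I (Ext (ModuleCat.of R (R ⧸ P)) (ModuleCat.of R M) 1))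
    (φ : P →ₗ[R] M) : ∃ s : R, s - 1 ∈ I ∧ ∃ m : M, ∀ p : P, s • φ p = (p : R) • m := by
  obtain ⟨s, hs, h⟩ := h
  have hex : Function.Exact P.subtype P.mkQ := LinearMap.exact_subtype_mkQ P
  let S : ShortComplex (ModuleCat.{u} R) :=
    ModuleCat.shortComplexOfCompEqZero P.subtype P.mkQ hex.linearMap_comp_eq_zero
  have hS : S.ShortExact :=
    { exact := ModuleCat.shortComplex_exact _ hex
      mono_f := (ModuleCat.mono_iff_injective _).2 P.injective_subtype
      epi_g := (ModuleCat.epi_iff_surjective _).2 P.mkQ_surjective }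
  let e : Ext S.X₁ (ModuleCat.of R M) 0 := Ext.mk₀ (ModuleCat.ofHom φ)
  obtain ⟨x, hx⟩ := Ext.contravariant_sequence_exact₁ hS (ModuleCat.of R M)
    (s • e) (add_zero 1) (by
      rw [Ext.comp_smul]
      exact h _)
  obtain ⟨ψ, rfl⟩ := Ext.addEquiv₀.symm.surjective x
  refine ⟨s, hs, ψ.hom (1 : R), fun p => ?_⟩
  have hx' : Ext.mk₀ (S.f ≫ ψ) = Ext.mk₀ (s • (ModuleCat.ofHom φ : S.X₁ ⟶ ModuleCat.of R M)) := by
    rw [Ext.mk₀_smul, ← Ext.mk₀_comp_mk₀]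
    exact hx
  have h2 := (Ext.mk₀_bijective _ _).1 hx'
  have h3 := congrArg (fun f => (ModuleCat.Hom.hom f) p) h2
  have h4 : ψ.hom (p : R) = s • φ p := h3
  rw [← h4, ← map_smul, smul_eq_mul, mul_one]

lemma smul_top_quotient_lt_top {I J : Ideal R} (hI : I ≠ ⊤) (hJ : J ≤ I) :
    I • (⊤ : Submodule R (R ⧸ J)) < ⊤ := by
  refine lt_top_iff_ne_top.2 fun h => hI ?_
  have h1 := congrArg (Submodule.map (Submodule.factor hJ)) h
  rw [Submodule.map_smul'', Submodule.map_top,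
    LinearMap.range_eq_top.2 (Submodule.factor_surjective hJ)] at h1
  have h2 : (Submodule.Quotient.mk 1 : R ⧸ I) ∈ I • (⊤ : Submodule R (R ⧸ I)) := by
    rw [h1]; trivial
  have h3 : I • (⊤ : Submodule R (R ⧸ I)) ≤ ⊥ := Submodule.smul_le.2 fun r hr n _ => by
    obtain ⟨a, rfl⟩ := Submodule.Quotient.mk_surjective _ n
    exact (Submodule.Quotient.mk_eq_zero _).2 (I.mul_mem_right a hr)
  exact (Ideal.eq_top_iff_one I).2 ((Submodule.Quotient.mk_eq_zero _).1 (h3 h2))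

lemma support_quotient (I : Ideal R) :
    Module.support R (R ⧸ I) = PrimeSpectrum.zeroLocus I := by
  rw [Module.support_eq_zeroLocus, Ideal.annihilator_quotient]

/-- One direction of Rees's theorem; the next lemma is the other. -/
lemma exists_isRegular_of_extVanishesBelow [IsNoetherianRing R] {I J : Ideal R} (hI : I ≠ ⊤)
    (hJ : J ≤ I) {d : ℕ} (h : ExtVanishesBelow I (R ⧸ J) d) :
    ∃ rs : List R, rs.length = d ∧ (∀ r ∈ rs, r ∈ I) ∧
      RingTheory.Sequence.IsRegular (R ⧸ J) rs :=
  ModuleCat.exists_isRegular_of_exists_subsingleton_ext I d (ModuleCat.of R (R ⧸ J))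
    (smul_top_quotient_lt_top hI hJ) (ModuleCat.of R (R ⧸ I)) (support_quotient I) h

lemma extVanishesBelow_of_isRegular [IsNoetherianRing R] {I J : Ideal R} (hI : I ≠ ⊤)
    (hJ : J ≤ I) {rs : List R} (hrs : ∀ r ∈ rs, r ∈ I)
    (h : RingTheory.Sequence.IsRegular (R ⧸ J) rs) :
    ExtVanishesBelow I (R ⧸ J) rs.length :=
  ModuleCat.subsingleton_ext_of_exists_isRegular I (ModuleCat.of R (R ⧸ I))
    (support_quotient I).subset (ModuleCat.of R (R ⧸ J)) (smul_top_quotient_lt_top hI hJ) rs hrs h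

end ExtDepth

/-! ### Monomial ideals as upper sets of exponents. -/

section MonomialIdeal

variable (K : Type*) [Field K] {σ : Type*}

/-- The ideal generated by the monomials with exponents in `U`. -/
noncomputable def monomialIdeal (U : Set (σ →₀ ℕ)) : Ideal (MvPolynomial σ K) :=
  Ideal.span ((fun a => monomial a (1 : K)) '' U)

variable {K}

lemma mem_monomialIdeal {U : Set (σ →₀ ℕ)} (hU : IsUpperSet U) {x : MvPolynomial σ K} :
    x ∈ monomialIdeal K U ↔ ∀ a ∈ x.support, a ∈ U := by
  rw [monomialIdeal, mem_ideal_span_monomial_image]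
  exact forall₂_congr fun a _ => ⟨fun ⟨b, hb, hba⟩ => hU hba hb, fun ha => ⟨a, ha, le_rfl⟩⟩

lemma isUpperSet_shift {U : Set (σ →₀ ℕ)} (hU : IsUpperSet U) (v : σ) :
    IsUpperSet {a | Finsupp.single v 1 + a ∈ U} :=
  fun _ _ hab ha => hU (add_le_add_right hab _) ha

lemma mem_monomialIdeal_shift {U : Set (σ →₀ ℕ)} (hU : IsUpperSet U) (v : σ)
    (x : MvPolynomial σ K) :
    x ∈ monomialIdeal K {a | Finsupp.single v 1 + a ∈ U} ↔ X v * x ∈ monomialIdeal K U := by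
  rw [mem_monomialIdeal hU, mem_monomialIdeal (isUpperSet_shift hU v), support_X_mul]
  simp

lemma monomialIdeal_sup_X (U : Set (σ →₀ ℕ)) (v : σ) :
    monomialIdeal K (U ∪ {a | a v ≠ 0}) = monomialIdeal K U ⊔ Ideal.span {X v} := by
  rw [monomialIdeal, Set.image_union, Ideal.span_union]
  congr 1
  apply le_antisymm
  · rw [Ideal.span_le]
    rintro _ ⟨a, ha, rfl⟩
    rw [← Set.image_singleton (f := X)]
    refine (mem_ideal_span_X_image (σ := σ) (R := K)).2 fun m hm => ⟨v, rfl, ?_⟩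
    have := support_monomial_subset hm
    rw [Finset.mem_singleton] at this
    rwa [this]
  · rw [Ideal.span_le, Set.singleton_subset_iff]
    exact Ideal.subset_span ⟨Finsupp.single v 1, by simp, rfl⟩

end MonomialIdeal

/-! ### Products of edges and colons of powers of edge ideals. -/

section EdgeSum

variable {σ : Type*} (G : SimpleGraph σ)

/-- The exponents of the products of `k` edges of `G`. -/
def EdgeSum : ℕ → Set (σ →₀ ℕ)
  | 0 => {0}
  | k + 1 => {a | ∃ u v, G.Adj u v ∧ ∃ b ∈ EdgeSum k,
      a = Finsupp.single u 1 + Finsupp.single v 1 + b}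

variable {G}

lemma edgeSum_edge {u v : σ} (h : G.Adj u v) {k : ℕ} {b : σ →₀ ℕ} (hb : b ∈ EdgeSum G k) :
    Finsupp.single u 1 + Finsupp.single v 1 + b ∈ EdgeSum G (k + 1) := ⟨u, v, h, b, hb, rfl⟩

lemma exists_edge_at_of_mem_edgeSum {k : ℕ} {b : σ →₀ ℕ} (hb : b ∈ EdgeSum G (k + 1)) {v : σ}
    (hv : b v ≠ 0) : ∃ x, G.Adj v x ∧ ∃ c ∈ EdgeSum G k,
      b = Finsupp.single v 1 + Finsupp.single x 1 + c := by
  classical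
  induction k generalizing b with
  | zero =>
    obtain ⟨x, y, hxy, c, hc, rfl⟩ := hb
    obtain rfl : c = 0 := hc
    by_cases hxv : x = v
    · subst hxv
      exact ⟨y, hxy, 0, rfl, rfl⟩
    by_cases hyv : y = v
    · subst hyv
      exact ⟨x, hxy.symm, 0, rfl, by abel⟩
    · simp [hxv, hyv] at hv
  | succ k ih =>
    obtain ⟨x, y, hxy, c, hc, rfl⟩ := hb
    by_cases hxv : x = v
    · subst hxv
      exact ⟨y, hxy, c, hc, rfl⟩
    by_cases hyv : y = v
    · subst hyv
      exact ⟨x, hxy.symm, c, hc, by abel⟩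
    · obtain ⟨z, hz, e, he, rfl⟩ := ih hc (by simpa [Finsupp.single_apply, hxv, hyv] using hv)
      exact ⟨z, hz, _, edgeSum_edge hxy he, by abel⟩

/-- Dropping one edge from the product absorbs the extra factor `X_v`: an edge at `v` if `v` occurs,
any edge otherwise. -/
lemma exists_edgeSum_le_of_le_single_add {k : ℕ} {a b : σ →₀ ℕ} {v : σ}
    (hb : b ∈ EdgeSum G (k + 1)) (hba : b ≤ Finsupp.single v 1 + a) :
    ∃ c ∈ EdgeSum G k, c ≤ a := by
  classical
  by_cases hv : b v = 0
  · obtain ⟨x, y, hxy, c, hc, rfl⟩ := hb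
    refine ⟨c, hc, fun z => ?_⟩
    have h := hba z
    by_cases hz : v = z
    · subst hz
      simp only [Finsupp.add_apply] at hv
      omega
    · simp only [Finsupp.add_apply, Finsupp.single_eq_of_ne' hz] at h
      omega
  · obtain ⟨x, hx, c, hc, rfl⟩ := exists_edge_at_of_mem_edgeSum hb hv
    refine ⟨c, hc, fun z => ?_⟩
    have h := hba z
    simp only [Finsupp.add_apply] at h
    omega

variable (G)

/-- The exponents of the monomials in `(X_w : w ∈ W) + I(G) ^ k`. -/
def killedExponents (W : Finset σ) (k : ℕ) : Set (σ →₀ ℕ) :=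
  {a | (∃ w ∈ W, a w ≠ 0) ∨ ∃ b ∈ EdgeSum G k, b ≤ a}

variable {G}

lemma isUpperSet_killedExponents (W : Finset σ) (k : ℕ) :
    IsUpperSet (killedExponents G W k) := by
  rintro a b hab (⟨w, hw, h⟩ | ⟨c, hc, h⟩)
  · refine Or.inl ⟨w, hw, ?_⟩
    have := hab w
    omega
  · exact Or.inr ⟨c, hc, h.trans hab⟩

lemma killedExponents_insert [DecidableEq σ] (W : Finset σ) (k : ℕ) (v : σ) :
    killedExponents G (insert v W) k = killedExponents G W k ∪ {a | a v ≠ 0} := by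
  ext a
  constructor
  · rintro (⟨w, hw, h⟩ | h)
    · rcases Finset.mem_insert.1 hw with rfl | hw
      · exact Or.inr h
      · exact Or.inl (Or.inl ⟨w, hw, h⟩)
    · exact Or.inl (Or.inr h)
  · rintro ((⟨w, hw, h⟩ | h) | h)
    · exact Or.inl ⟨w, Finset.mem_insert_of_mem hw, h⟩
    · exact Or.inr h
    · exact Or.inl ⟨v, Finset.mem_insert_self _ _, h⟩

/-- A product `b` of edges that avoids `u` loses at most the factor `X_v`, so dropping one edge
suffices. If `b` involves `u`, some edge at `u` can be split off from it, and that edge is `uv` or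
ends in `W`. -/
lemma killedExponents_leaf {W : Finset σ} {u v : σ} (huv : G.Adj u v) (hu : u ∉ W) (hv : v ∉ W)
    (hleaf : ∀ x, G.Adj u x → x ∈ W ∨ x = v) (k : ℕ) (a : σ →₀ ℕ) :
    Finsupp.single u 1 + (Finsupp.single v 1 + a) ∈ killedExponents G W (k + 1) ↔
      a ∈ killedExponents G W k := by
  classical
  constructor
  · have hW : ∀ w ∈ W, (Finsupp.single u 1 + (Finsupp.single v 1 + a) : σ →₀ ℕ) w ≠ 0 → a w ≠ 0 := by
      intro w hw h
      have h1 : u ≠ w := fun h => hu (h ▸ hw)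
      have h2 : v ≠ w := fun h => hv (h ▸ hw)
      simpa [Finsupp.single_apply, h1, h2] using h
    rintro (⟨w, hw, h⟩ | ⟨b, hb, h⟩)
    · exact Or.inl ⟨w, hw, hW w hw h⟩
    by_cases hbW : ∃ w ∈ W, b w ≠ 0
    · obtain ⟨w, hw, hbw⟩ := hbW
      refine Or.inl ⟨w, hw, hW w hw ?_⟩
      have := h w
      omega
    by_cases hbu : b u = 0
    · refine Or.inr (exists_edgeSum_le_of_le_single_add (v := v) hb fun z => ?_)
      by_cases hz : u = z
      · subst hz
        omega
      · have := h z
        rwa [Finsupp.add_apply, Finsupp.single_eq_of_ne' hz, zero_add] at this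
    · obtain ⟨x, hx, c, hc, rfl⟩ := exists_edge_at_of_mem_edgeSum hb hbu
      rcases hleaf x hx with hxW | rfl
      · exact absurd ⟨x, hxW, by simp⟩ hbW
      · rw [← add_assoc] at h
        exact Or.inr ⟨c, hc, le_of_add_le_add_left h⟩
  · rintro (⟨w, hw, h⟩ | ⟨b, hb, h⟩)
    · exact Or.inl ⟨w, hw, by simp [h]⟩
    · exact Or.inr ⟨_, edgeSum_edge huv hb, by rw [← add_assoc]; exact add_le_add_right h _⟩

lemma killedExponents_isolated {W : Finset σ} {v : σ} (hv : v ∉ W)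
    (hiso : ∀ x, G.Adj v x → x ∈ W) (k : ℕ) (a : σ →₀ ℕ) :
    Finsupp.single v 1 + a ∈ killedExponents G W k ↔ a ∈ killedExponents G W k := by
  classical
  refine ⟨?_, fun h => isUpperSet_killedExponents W k le_add_self h⟩
  have hW : ∀ w ∈ W, (Finsupp.single v 1 + a : σ →₀ ℕ) w ≠ 0 → a w ≠ 0 := by
    intro w hw h
    have h2 : v ≠ w := fun h => hv (h ▸ hw)
    simpa [Finsupp.single_apply, h2] using h
  rintro (⟨w, hw, h⟩ | ⟨b, hb, h⟩)
  · exact Or.inl ⟨w, hw, hW w hw h⟩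
  by_cases hbv : b v = 0
  · refine Or.inr ⟨b, hb, fun z => ?_⟩
    by_cases hz : v = z
    · subst hz
      omega
    · have := h z
      rwa [Finsupp.add_apply, Finsupp.single_eq_of_ne' hz, zero_add] at this
  · cases k with
    | zero => exact absurd (by rw [show b = 0 from hb]; rfl) hbv
    | succ k =>
      obtain ⟨x, hx, c, hc, rfl⟩ := exists_edge_at_of_mem_edgeSum hb hbv
      refine Or.inl ⟨x, hiso x hx, hW x (hiso x hx) ?_⟩
      have := h x
      simp only [Finsupp.add_apply, Finsupp.single_eq_same] at this ⊢
      omega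

lemma edgeIdeal_pow_eq (K : Type*) [Field K] (k : ℕ) :
    edgeIdeal K G ^ k = monomialIdeal K (killedExponents G ∅ k) := by
  have h1 : edgeIdeal K G ^ k = monomialIdeal K (EdgeSum G k) := by
    induction k with
    | zero =>
      rw [pow_zero, monomialIdeal, EdgeSum, Set.image_singleton, Ideal.one_eq_top]
      exact Ideal.span_singleton_one.symm
    | succ k ih =>
      rw [pow_succ', ih, edgeIdeal, monomialIdeal, monomialIdeal, Ideal.span_mul_span']
      congr 1
      ext f
      constructor
      · rintro ⟨_, ⟨u, v, huv, rfl⟩, _, ⟨b, hb, rfl⟩, rfl⟩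
        refine ⟨_, edgeSum_edge huv hb, ?_⟩
        simp [X, monomial_mul]
      · rintro ⟨_, ⟨u, v, huv, b, hb, rfl⟩, rfl⟩
        refine ⟨_, ⟨u, v, huv, rfl⟩, _, ⟨b, hb, rfl⟩, ?_⟩
        simp [X, monomial_mul]
  rw [h1]
  apply le_antisymm
  · exact Ideal.span_mono (Set.image_mono fun b hb => Or.inr ⟨b, hb, le_rfl⟩)
  · refine Ideal.span_le.2 ?_
    rintro _ ⟨a, ha, rfl⟩
    rcases ha with ⟨w, hw, _⟩ | ⟨b, hb, hba⟩
    · simp at hw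
    · refine mem_ideal_span_monomial_image.2 fun m hm => ⟨b, hb, ?_⟩
      have := support_monomial_subset hm
      rw [Finset.mem_singleton] at this
      rwa [this]

end EdgeSum

/-! ### Packings in forests under deletion of vertices. -/

section LowerBound

/-- Every nonempty finite set of vertices has a member with at most one neighbour in the set. -/
def IsOneDegenerate {σ : Type*} (G : SimpleGraph σ) : Prop :=
  ∀ A : Finset σ, A.Nonempty → ∃ v ∈ A, ∃ z, ∀ x ∈ A, G.Adj v x → x = z

/-- The vertices in `T` are pairwise at distance at least three in `G - W`. -/
structure IsPacking {σ : Type*} (G : SimpleGraph σ) (W T : Finset σ) : Prop where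
  notMem : ∀ t ∈ T, t ∉ W
  not_adj : ∀ s ∈ T, ∀ t ∈ T, ¬ G.Adj s t
  not_common : ∀ s ∈ T, ∀ t ∈ T, s ≠ t → ∀ x, G.Adj s x → G.Adj t x → x ∈ W

variable {σ : Type*} {G : SimpleGraph σ}

/-- In a forest `G - W` with an edge there is a vertex with a leaf neighbour, all of whose
neighbours except at most one are leaves. -/
lemma IsOneDegenerate.exists_near_leaves [Fintype σ] (hG : IsOneDegenerate G) {W : Finset σ}
    (hedge : ∃ u v, u ∉ W ∧ v ∉ W ∧ G.Adj u v) :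
    ∃ v u z, v ∉ W ∧ u ∉ W ∧ G.Adj v u ∧ (∀ y, G.Adj u y → y ∈ W ∨ y = v) ∧
      ∀ x, x ∉ W → G.Adj v x → x ≠ z → ∀ y, G.Adj x y → y ∈ W ∨ y = v := by
  classical
  -- `A` is the set of vertices with at least two neighbours in `G - W`. A vertex of `A` with at
  -- most one neighbour in `A` has a leaf neighbour; if `A` is empty, every edge of `G - W` is a
  -- component.
  let A : Finset σ := {v | v ∉ W ∧ ¬ ∃ z, ∀ x, x ∉ W → G.Adj v x → x = z}
  have leaf : ∀ v x, v ∉ W → G.Adj v x → x ∉ W → x ∉ A → ∀ y, G.Adj x y → y ∈ W ∨ y = v := by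
    intro v x hv hvx hx hxA y hxy
    simp only [A, Finset.mem_filter, Finset.mem_univ, true_and, not_and, not_not] at hxA
    obtain ⟨z, hz⟩ := hxA hx
    by_cases hy : y ∈ W
    · exact Or.inl hy
    · exact Or.inr ((hz y hy hxy).trans (hz v hv hvx.symm).symm)
  by_cases hA : A.Nonempty
  · obtain ⟨v, hvA, z, hz⟩ := hG A hA
    have hv := hvA
    simp only [A, Finset.mem_filter, Finset.mem_univ, true_and, not_exists, not_forall] at hv
    obtain ⟨hvW, h⟩ := hv
    obtain ⟨u, hu, hvu, huz⟩ := h z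
    have key : ∀ x, x ∉ W → G.Adj v x → x ≠ z → ∀ y, G.Adj x y → y ∈ W ∨ y = v :=
      fun x hx hvx hxz => leaf v x hvW hvx hx fun hxA => hxz (hz x hxA hvx)
    exact ⟨v, u, z, hvW, hu, hvu, key u hu hvu huz, key⟩
  · rw [Finset.not_nonempty_iff_eq_empty] at hA
    obtain ⟨v, u, hv, hu, hvu⟩ := hedge
    have key : ∀ x, x ∉ W → G.Adj v x → ∀ y, G.Adj x y → y ∈ W ∨ y = v :=
      fun x hx hvx => leaf v x hv hvx hx (by simp [hA])
    exact ⟨v, u, v, hv, hu, hvu, key u hu hvu, fun x hx hvx _ => key x hx hvx⟩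

/-- If `v` lies in `T`, it is exchanged for its leaf `u`, which is isolated once `v` is gone. -/
lemma IsPacking.remove_center [DecidableEq σ] {W T : Finset σ} (hT : IsPacking G W T) {v u : σ} (hu : u ∉ W)
    (hvu : G.Adj v u) (hleaf : ∀ y, G.Adj u y → y ∈ W ∨ y = v) :
    ∃ T', IsPacking G (insert v W) T' ∧ T.card ≤ T'.card := by
  by_cases hvT : v ∈ T
  · have huT : u ∉ T := fun h => hT.not_adj v hvT u h hvu
    have hne : ∀ t ∈ T.erase v, ¬ G.Adj u t := fun t ht h => by
      rcases hleaf t h with h | h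
      · exact hT.notMem t (Finset.mem_of_mem_erase ht) h
      · exact Finset.ne_of_mem_erase ht h
    have hin : ∀ y, G.Adj u y → y ∈ insert v W := fun y hy =>
      Finset.mem_insert.2 (hleaf y hy).symm
    refine ⟨insert u (T.erase v), ⟨?_, ?_, ?_⟩, ?_⟩
    · intro t ht
      rcases Finset.mem_insert.1 ht with rfl | ht
      · simpa [hu] using hvu.ne'
      · simpa [hT.notMem t (Finset.mem_of_mem_erase ht)] using Finset.ne_of_mem_erase ht
    · intro s hs t ht
      rcases Finset.mem_insert.1 hs with rfl | hs' <;> rcases Finset.mem_insert.1 ht with rfl | ht'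
      · exact G.irrefl
      · exact hne t ht'
      · exact fun h => hne s hs' h.symm
      · exact hT.not_adj s (Finset.mem_of_mem_erase hs') t (Finset.mem_of_mem_erase ht')
    · intro s hs t ht hst x hsx htx
      rcases Finset.mem_insert.1 hs with rfl | hs
      · exact hin x hsx
      rcases Finset.mem_insert.1 ht with rfl | ht
      · exact hin x htx
      · exact Finset.mem_insert_of_mem (hT.not_common s (Finset.mem_of_mem_erase hs) t
          (Finset.mem_of_mem_erase ht) hst x hsx htx)
    · rw [Finset.card_insert_of_notMem (fun h => huT (Finset.mem_of_mem_erase h)),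
        Finset.card_erase_of_mem hvT]
      omega
  · refine ⟨T, ⟨fun t ht => ?_, hT.not_adj, fun s hs t ht hst x hsx htx =>
      Finset.mem_insert_of_mem (hT.not_common s hs t ht hst x hsx htx)⟩, le_rfl⟩
    rw [Finset.mem_insert]
    rintro (rfl | h)
    · exact hvT ht
    · exact hT.notMem t ht h

/-- The deleted members of `T` are neighbours of `v ∉ W`, and a packing contains at most one such
vertex. -/
lemma IsPacking.remove_some_neighbors {W W' T : Finset σ} (hT : IsPacking G W T) (hW : W ⊆ W')
    {v : σ} (hv : v ∉ W) (hN : ∀ x ∈ W', x ∈ W ∨ G.Adj v x) :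
    ∃ T', IsPacking G W' T' ∧ T.card ≤ T'.card + 1 := by
  classical
  refine ⟨T \ W', ⟨fun t ht => (Finset.mem_sdiff.1 ht).2,
    fun s hs t ht => hT.not_adj s (Finset.mem_sdiff.1 hs).1 t (Finset.mem_sdiff.1 ht).1,
    fun s hs t ht hst x hsx htx => hW (hT.not_common s (Finset.mem_sdiff.1 hs).1 t
      (Finset.mem_sdiff.1 ht).1 hst x hsx htx)⟩, ?_⟩
  have h1 : (T ∩ W').card ≤ 1 := by
    rw [Finset.card_le_one]
    have hadj : ∀ s ∈ T ∩ W', G.Adj s v := fun s hs => by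
      rw [Finset.mem_inter] at hs
      exact ((hN s hs.2).resolve_left (hT.notMem s hs.1)).symm
    intro s hs t ht
    by_contra hst
    exact hv (hT.not_common s (Finset.mem_inter.1 hs).1 t (Finset.mem_inter.1 ht).1 hst v
      (hadj s hs) (hadj t ht))
  have := Finset.card_sdiff_add_card_inter T W'
  omega

/-- If a member of `T` is deleted, it is exchanged for `v`, which has become isolated. -/
lemma IsPacking.remove_all_neighbors {W W' T : Finset σ} (hT : IsPacking G W T) (hW : W ⊆ W')
    {v : σ} (hv : v ∉ W') (hN : ∀ x, x ∈ W' ↔ x ∈ W ∨ G.Adj v x) :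
    ∃ T', IsPacking G W' T' ∧ T.card ≤ T'.card := by
  classical
  have hvW : v ∉ W := fun h => hv (hW h)
  by_cases h : ∃ t ∈ T, G.Adj v t
  · obtain ⟨t, htT, hvt⟩ := h
    have hvT : v ∉ T := fun h => hT.not_adj v h t htT hvt
    have hnv : ∀ s ∈ T.erase t, ¬ G.Adj v s := fun s hs hvs =>
      hvW (hT.not_common s (Finset.mem_of_mem_erase hs) t htT (Finset.ne_of_mem_erase hs) v
        hvs.symm hvt.symm)
    refine ⟨insert v (T.erase t), ⟨?_, ?_, ?_⟩, ?_⟩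
    · intro s hs
      rcases Finset.mem_insert.1 hs with rfl | hs
      · exact hv
      · rw [hN]
        rintro (h | h)
        · exact hT.notMem s (Finset.mem_of_mem_erase hs) h
        · exact hnv s hs h
    · intro s hs r hr
      rcases Finset.mem_insert.1 hs with rfl | hs' <;> rcases Finset.mem_insert.1 hr with rfl | hr'
      · exact G.irrefl
      · exact hnv r hr'
      · exact fun h => hnv s hs' h.symm
      · exact hT.not_adj s (Finset.mem_of_mem_erase hs') r (Finset.mem_of_mem_erase hr')
    · intro s hs r hr hsr x hsx hrx
      rcases Finset.mem_insert.1 hs with rfl | hs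
      · exact (hN x).2 (Or.inr hsx)
      rcases Finset.mem_insert.1 hr with rfl | hr
      · exact (hN x).2 (Or.inr hrx)
      · exact hW (hT.not_common s (Finset.mem_of_mem_erase hs) r
          (Finset.mem_of_mem_erase hr) hsr x hsx hrx)
    · rw [Finset.card_insert_of_notMem (fun h => hvT (Finset.mem_of_mem_erase h)),
        Finset.card_erase_of_mem htT]
      omega
  · push Not at h
    refine ⟨T, ⟨fun t ht => ?_, hT.not_adj, fun s hs t ht hst x hsx htx =>
      hW (hT.not_common s hs t ht hst x hsx htx)⟩, le_rfl⟩
    rw [hN]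
    rintro (h' | h')
    · exact hT.notMem t ht h'
    · exact h t ht h'

end LowerBound

/-! ### The lower bound for the depth. -/

section LowerBoundDepth

variable {σ : Type*} {G : SimpleGraph σ} {K : Type*} [Field K]

lemma X_mem_idealOfVars (v : σ) : (X v : MvPolynomial σ K) ∈ idealOfVars σ K :=
  Ideal.subset_span ⟨v, rfl⟩

lemma monomialIdeal_killedExponents_insert [DecidableEq σ] (W : Finset σ) (k : ℕ) (v : σ) :
    monomialIdeal K (killedExponents G (insert v W) k) =
      monomialIdeal K (killedExponents G W k) ⊔ Ideal.span {X v} := by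
  rw [killedExponents_insert, monomialIdeal_sup_X]

variable [Fintype σ] [DecidableEq σ]

lemma extVanishesBelow_of_no_edge (k n : ℕ) (W : Finset σ) (hn : Wᶜ.card = n)
    (h : ∀ u v, u ∉ W → v ∉ W → ¬ G.Adj u v) :
    ExtVanishesBelow (idealOfVars σ K)
      (MvPolynomial σ K ⧸ monomialIdeal K (killedExponents G W (k + 1))) n := by
  induction n generalizing W with
  | zero => exact fun i hi => absurd hi (Nat.not_lt_zero i)
  | succ n ih =>
    obtain ⟨v, hv⟩ := Finset.card_pos.1 (by omega : 0 < Wᶜ.card)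
    rw [Finset.mem_compl] at hv
    refine ExtVanishesBelow.succ (X_mem_idealOfVars v) (fun a => ?_)
      (monomialIdeal_killedExponents_insert W (k + 1) v)
      (ih (insert v W) ?_ fun x y hx hy => h x y (fun h => hx (Finset.mem_insert_of_mem h))
        fun h => hy (Finset.mem_insert_of_mem h))
    · rw [← mem_monomialIdeal_shift (isUpperSet_killedExponents W (k + 1)) v a]
      have : {a | Finsupp.single v 1 + a ∈ killedExponents G W (k + 1)} =
          killedExponents G W (k + 1) :=
        Set.ext fun a => killedExponents_isolated hv
          (fun x hx => by_contra fun hxW => h v x hv hxW hx) _ a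
      rw [this]
    · rw [Finset.card_compl, Finset.card_insert_of_notMem hv]
      rw [Finset.card_compl] at hn
      omega

/-- The colon of `(X_w : w ∈ W) + I(G) ^ (k + 1)` by `X_v` has the depth bound, if `v` has at most
one neighbour that is not a leaf. -/
lemma extVanishesBelow_colon {W : Finset σ} {v z : σ} (hv : v ∉ W)
    (hz : ∀ x, x ∉ W → G.Adj v x → x ≠ z → ∀ y, G.Adj x y → y ∈ W ∨ y = v) {k d : ℕ}
    (hk : ∀ W', W ⊆ W' → (∀ x ∈ W', x ∈ W ∨ G.Adj v x) → ExtVanishesBelow (idealOfVars σ K)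
      (MvPolynomial σ K ⧸ monomialIdeal K (killedExponents G W' k)) d)
    (hall : ∀ W', W ⊆ W' → (∀ x, x ∈ W' ↔ x ∈ W ∨ G.Adj v x) → ExtVanishesBelow (idealOfVars σ K)
      (MvPolynomial σ K ⧸ monomialIdeal K (killedExponents G W' (k + 1))) d)
    (n : ℕ) (W' : Finset σ) (hn : W'ᶜ.card = n) (hW : W ⊆ W')
    (hN : ∀ x ∈ W', x ∈ W ∨ G.Adj v x) :
    ExtVanishesBelow (idealOfVars σ K) (MvPolynomial σ K ⧸ monomialIdeal K
      {a | Finsupp.single v 1 + a ∈ killedExponents G W' (k + 1)}) d := by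
  induction n generalizing W' with
  | zero =>
    have : v ∉ W' := fun h => (hN v h).elim hv G.irrefl
    have := Finset.card_pos.2 ⟨v, Finset.mem_compl.2 this⟩
    omega
  | succ n ih =>
    have hvW' : v ∉ W' := fun h => (hN v h).elim hv G.irrefl
    by_cases hrem : ∃ x, x ∉ W' ∧ G.Adj v x
    · obtain ⟨x, hx, hvx, hleaf⟩ : ∃ x, x ∉ W' ∧ G.Adj v x ∧
          ((∀ y, G.Adj x y → y ∈ W' ∨ y = v) ∨ (∀ y, G.Adj v y → y ∈ W' ∨ y = x)) := by
        by_cases h : ∃ x, x ∉ W' ∧ G.Adj v x ∧ x ≠ z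
        · obtain ⟨x, hx, hvx, hxz⟩ := h
          exact ⟨x, hx, hvx, Or.inl fun y hy =>
            (hz x (fun h => hx (hW h)) hvx hxz y hy).imp_left fun h => hW h⟩
        · push Not at h
          obtain ⟨x, hx, hvx⟩ := hrem
          refine ⟨x, hx, hvx, Or.inr fun y hy => ?_⟩
          by_cases hyW : y ∈ W'
          · exact Or.inl hyW
          · exact Or.inr ((h y hyW hy).trans (h x hx hvx).symm)
      refine ExtVanishesBelow.of_colon (J₁ := monomialIdeal K (killedExponents G W' k))
        (f := X x) (J₂ := monomialIdeal K
          {a | Finsupp.single v 1 + a ∈ killedExponents G (insert x W') (k + 1)})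
        (fun a => ?_) ?_ (hk W' hW hN) (ih (insert x W') ?_ ?_ ?_)
      · rw [← mem_monomialIdeal_shift (isUpperSet_shift (isUpperSet_killedExponents W' _) v)]
        have : {a | Finsupp.single x 1 + a ∈
            {a | Finsupp.single v 1 + a ∈ killedExponents G W' (k + 1)}} =
            killedExponents G W' k := by
          ext a
          rcases hleaf with h | h
          · refine Iff.trans ?_ (killedExponents_leaf hvx.symm hx hvW' h k a)
            rw [add_left_comm]
            rfl
          · exact killedExponents_leaf hvx hvW' hx h k a
        rw [this]
      · rw [← monomialIdeal_sup_X, killedExponents_insert]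
        congr 1
        ext a
        have hxv : (Finsupp.single v 1 + a : σ →₀ ℕ) x = a x := by
          rw [Finsupp.add_apply, Finsupp.single_eq_of_ne' hvx.ne, zero_add]
        show _ ∨ (Finsupp.single v 1 + a : σ →₀ ℕ) x ≠ 0 ↔ _ ∨ a x ≠ 0
        rw [hxv]
        rfl
      · rw [Finset.card_compl, Finset.card_insert_of_notMem hx]
        rw [Finset.card_compl] at hn
        omega
      · exact hW.trans (Finset.subset_insert _ _)
      · intro y hy
        rcases Finset.mem_insert.1 hy with rfl | hy
        · exact Or.inr hvx
        · exact hN y hy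
    · push Not at hrem
      -- All neighbours of `v` are now deleted, so `X_v` is a nonzerodivisor and the colon by it
      -- changes nothing.
      have hiso : ∀ x, G.Adj v x → x ∈ W' := fun x hx => by_contra fun h => hrem x h hx
      have : {a | Finsupp.single v 1 + a ∈ killedExponents G W' (k + 1)} =
          killedExponents G W' (k + 1) :=
        Set.ext fun a => killedExponents_isolated hvW' hiso _ a
      rw [this]
      exact hall W' hW fun x => ⟨hN x, fun h => h.elim (fun h => hW h) (hiso x)⟩

/-- If `T` is a set of vertices of the forest `G - W` at pairwise distance at least three, then
`(X_w : w ∈ W) + I(G) ^ k` has depth at least `|T| + 1 - k`. -/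
theorem IsPacking.extVanishesBelow (hG : IsOneDegenerate G) (k : ℕ) {W T : Finset σ}
    (hT : IsPacking G W T) {d : ℕ} (hd : d + k ≤ T.card + 1) :
    ExtVanishesBelow (idealOfVars σ K)
      (MvPolynomial σ K ⧸ monomialIdeal K (killedExponents G W k)) d := by
  induction k generalizing W T d with
  | zero =>
    -- For the zeroth power the quotient is zero, so there is no constraint on `d`.
    have h : monomialIdeal K (killedExponents G W 0) = ⊤ := by
      rw [Ideal.eq_top_iff_one]
      exact Ideal.subset_span ⟨0, Or.inr ⟨0, rfl, le_rfl⟩, rfl⟩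
    have : Subsingleton (MvPolynomial σ K ⧸ monomialIdeal K (killedExponents G W 0)) :=
      Ideal.Quotient.subsingleton_iff.2 h
    exact extVanishesBelow_of_subsingleton _ _ _
  | succ k ihk =>
    induction hm : Wᶜ.card using Nat.strong_induction_on generalizing W T with
    | _ m ihm =>
    subst hm
    by_cases hedge : ∃ u v, u ∉ W ∧ v ∉ W ∧ G.Adj u v
    · obtain ⟨v, u, z, hv, hu, hvu, hleaf, hz⟩ := hG.exists_near_leaves hedge
      refine ExtVanishesBelow.of_colon (f := X v) (J₁ := monomialIdeal K
          {a | Finsupp.single v 1 + a ∈ killedExponents G W (k + 1)})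
        (fun a => mem_monomialIdeal_shift (isUpperSet_killedExponents W _) v a)
        (monomialIdeal_killedExponents_insert W (k + 1) v) ?_ ?_
      · refine extVanishesBelow_colon hv hz (fun W' hW hN => ?_) (fun W' hW hN => ?_) _ W rfl
          subset_rfl fun x hx => Or.inl hx
        · obtain ⟨T', hT', hc⟩ := hT.remove_some_neighbors hW hv hN
          exact ihk hT' (by omega)
        · obtain ⟨T', hT', hc⟩ := hT.remove_all_neighbors hW
            (fun h => ((hN v).1 h).elim hv G.irrefl) hN
          refine ihm W'ᶜ.card (Finset.card_lt_card ?_) hT' (by omega) rfl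
          rw [Finset.compl_ssubset_compl]
          exact (Finset.ssubset_iff_of_subset hW).2 ⟨u, (hN u).2 (Or.inr hvu), hu⟩
      · obtain ⟨T', hT', hc⟩ := hT.remove_center hu hvu hleaf
        refine ihm (insert v W)ᶜ.card (Finset.card_lt_card ?_) hT' (by omega) rfl
        rw [Finset.compl_ssubset_compl]
        exact Finset.ssubset_insert hv
    · push Not at hedge
      refine (extVanishesBelow_of_no_edge k _ W rfl fun u v hu hv => hedge u v hu hv).mono ?_
      have : T.card ≤ Wᶜ.card :=
        Finset.card_le_card fun t ht => Finset.mem_compl.2 (hT.notMem t ht)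
      omega

end LowerBoundDepth

/-! ### Nonvanishing of `Ext^1` from a disconnected annihilator. -/

section Obstruction

/-- Multiplication by `m` on `a` factors through `a ⧸ (a ⊓ b) ≅ (a ⊔ b) ⧸ b`. -/
lemma exists_extension_of_inf {R : Type*} [CommRing R] (a b : Ideal R) {M : Type*}
    [AddCommGroup M] [Module R M] (m : M) (h : ∀ x ∈ a ⊓ b, x • m = 0) :
    ∃ φ : (a ⊔ b : Ideal R) →ₗ[R] M, (∀ x (hx : x ∈ a), φ ⟨x, Submodule.mem_sup_left hx⟩ = x • m) ∧
      ∀ x (hx : x ∈ b), φ ⟨x, Submodule.mem_sup_right hx⟩ = 0 := by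
  let ψ : (a ⧸ Submodule.comap a.subtype a ⊓ Submodule.comap a.subtype b) →ₗ[R] M :=
    Submodule.liftQ _ ((LinearMap.toSpanSingleton R M m).comp a.subtype) fun x hx =>
      h x ⟨x.2, hx.2⟩
  refine ⟨(ψ.comp (LinearMap.quotientInfEquivSupQuotient a b).symm.toLinearMap).comp
    (Submodule.mkQ _), fun x hx => ?_, fun x hx => ?_⟩
  · have := LinearMap.quotientInfEquivSupQuotient_symm_apply_left a b
      ⟨x, Submodule.mem_sup_left hx⟩ hx
    show ψ ((LinearMap.quotientInfEquivSupQuotient a b).symm (Submodule.Quotient.mk _)) = _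
    rw [this]
    rfl
  · have := LinearMap.quotientInfEquivSupQuotient_symm_apply_right a b
      (x := ⟨x, Submodule.mem_sup_right hx⟩) hx
    show ψ ((LinearMap.quotientInfEquivSupQuotient a b).symm (Submodule.Quotient.mk _)) = _
    rw [this, map_zero]

variable {σ : Type*} {K : Type*} [Field K]

variable (K) in
/-- The ideal generated by the variables in `W`. -/
noncomputable def variableIdeal (W : Finset σ) : Ideal (MvPolynomial σ K) :=
  Ideal.span (X '' (W : Set σ))

lemma mem_variableIdeal {W : Finset σ} {x : MvPolynomial σ K} :
    x ∈ variableIdeal K W ↔ ∀ a ∈ x.support, ∃ w ∈ W, a w ≠ 0 :=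
  mem_ideal_span_X_image

lemma variableIdeal_univ [Fintype σ] :
    variableIdeal K (Finset.univ : Finset σ) = idealOfVars σ K := by
  rw [variableIdeal, Finset.coe_univ, Set.image_univ, idealOfVars]

lemma variableIdeal_insert [DecidableEq σ] (v : σ) (W : Finset σ) :
    variableIdeal K (insert v W) = variableIdeal K W ⊔ Ideal.span {X v} := by
  rw [variableIdeal, Finset.coe_insert, Set.image_insert_eq, Ideal.span_insert, sup_comm,
    variableIdeal]

lemma variableIdeal_union [DecidableEq σ] (W W' : Finset σ) :
    variableIdeal K W ⊔ variableIdeal K W' = variableIdeal K (W ∪ W') := by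
  rw [variableIdeal, variableIdeal, variableIdeal, Finset.coe_union, Set.image_union,
    Ideal.span_union]

lemma mem_variableIdeal_iff_X_mul {W : Finset σ} {v : σ} (hv : v ∉ W) (x : MvPolynomial σ K) :
    x ∈ variableIdeal K W ↔ X v * x ∈ variableIdeal K W := by
  classical
  refine ⟨fun h => Ideal.mul_mem_left _ _ h, fun h => ?_⟩
  rw [mem_variableIdeal] at h ⊢
  intro a ha
  obtain ⟨w, hw, h⟩ := h (Finsupp.single v 1 + a) (by rw [support_X_mul]; simpa using ha)
  have hvw : v ≠ w := fun h => hv (h ▸ hw)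
  exact ⟨w, hw, by simpa [Finsupp.single_apply, hvw] using h⟩

lemma one_notMem_idealOfVars : (1 : MvPolynomial σ K) ∉ idealOfVars σ K := by
  intro h
  rw [idealOfVars, ← Set.image_univ, mem_ideal_span_X_image] at h
  obtain ⟨i, -, hi⟩ := h 0 (by simp)
  exact hi rfl

lemma coeff_zero_of_sub_one_mem {s : MvPolynomial σ K} (h : s - 1 ∈ idealOfVars σ K) :
    coeff 0 s = 1 := by
  rw [idealOfVars, ← Set.image_univ, mem_ideal_span_X_image] at h
  by_contra hne
  obtain ⟨i, -, hi⟩ := h 0 (by simpa [mem_support_iff, sub_eq_zero] using hne)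
  exact hi rfl

/-- Vanishing of `Ext^i` from the residue field implies local vanishing of lower `Ext` from
quotients by variables. -/
lemma ExtVanishesBelow.killed [Fintype σ] {M : Type _}
    [AddCommGroup M] [Module (MvPolynomial σ K) M] [Module.Finite (MvPolynomial σ K) M] {d : ℕ}
    (h : ExtVanishesBelow (idealOfVars σ K) M d) (n i : ℕ) (W : Finset σ)
    (hn : (Finset.card W) + n = Fintype.card σ) (hi : i + n < d) :
    KilledByOneAdd (idealOfVars σ K) (Ext (ModuleCat.of _ (MvPolynomial σ K ⧸ variableIdeal K W))
      (ModuleCat.of (MvPolynomial σ K) M) i) := by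
  classical
  induction n generalizing i W with
  | zero =>
    obtain rfl : W = Finset.univ := (Finset.card_eq_iff_eq_univ W).1 hn
    rw [variableIdeal_univ]
    have := h i hi
    exact ⟨1, by simp, fun e => Subsingleton.elim _ _⟩
  | succ n ih =>
    obtain ⟨v, hv⟩ : ∃ v, v ∉ W := by
      by_contra hcon
      push Not at hcon
      rw [Finset.eq_univ_of_forall hcon, Finset.card_univ] at hn
      omega
    refine KilledByOneAdd.of_succ (X_mem_idealOfVars v) (mem_variableIdeal_iff_X_mul hv)
      (variableIdeal_insert v W) (ModuleCat.of (MvPolynomial σ K) M) (ih (i + 1) (insert v W) ?_ ?_)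
    · rw [Finset.card_insert_of_notMem hv]
      omega
    · omega

/-- If the annihilator of the monomial `w` modulo a monomial ideal contains the intersection of two
ideals of variables, each of which does not kill it, then `Ext^1` from the quotient by their sum does
not vanish at the origin. -/
lemma not_killed_ext_one [DecidableEq σ] {U : Set (σ →₀ ℕ)} (hU : IsUpperSet U) {A B : Finset σ}
    {w : σ →₀ ℕ}
    (hAB : ∀ m : σ →₀ ℕ, (∃ a ∈ A, m a ≠ 0) → (∃ b ∈ B, m b ≠ 0) → m + w ∈ U)
    (hA : ∃ a ∈ A, Finsupp.single a 1 + w ∉ U) (hB : ∃ b ∈ B, Finsupp.single b 1 + w ∉ U) :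
    ¬ KilledByOneAdd (idealOfVars σ K)
      (Ext (ModuleCat.of _ (MvPolynomial σ K ⧸ variableIdeal K (A ∪ B)))
        (ModuleCat.of (MvPolynomial σ K) (MvPolynomial σ K ⧸ monomialIdeal K U)) 1) := by
  intro hk
  rw [← variableIdeal_union] at hk
  obtain ⟨φ, hφA, hφB⟩ := exists_extension_of_inf (variableIdeal K A) (variableIdeal K B)
    (Submodule.Quotient.mk (monomial w 1) : MvPolynomial σ K ⧸ monomialIdeal K U) (by
      intro x hx
      rw [← Submodule.Quotient.mk_smul, Submodule.Quotient.mk_eq_zero, smul_eq_mul,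
        mem_monomialIdeal hU]
      intro e he
      obtain ⟨m, hm, c, hc, rfl⟩ := Finset.mem_add.1 (support_mul _ _ he)
      have := support_monomial_subset hc
      rw [Finset.mem_singleton] at this
      subst this
      exact hAB m (mem_variableIdeal.1 hx.1 m hm) (mem_variableIdeal.1 hx.2 m hm))
  obtain ⟨s, hs, m, hm⟩ := hk.exists_extension φ
  obtain ⟨q, rfl⟩ := Submodule.Quotient.mk_surjective _ m
  obtain ⟨a, haA, ha⟩ := hA
  obtain ⟨b, hbB, hb⟩ := hB
  have hmemA : (X a : MvPolynomial σ K) ∈ variableIdeal K A := Ideal.subset_span ⟨a, haA, rfl⟩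
  have hmemB : (X b : MvPolynomial σ K) ∈ variableIdeal K B := Ideal.subset_span ⟨b, hbB, rfl⟩
  have h1 := hm ⟨X a, Submodule.mem_sup_left hmemA⟩
  have h2 := hm ⟨X b, Submodule.mem_sup_right hmemB⟩
  rw [hφA _ hmemA, ← Submodule.Quotient.mk_smul, ← Submodule.Quotient.mk_smul,
    ← Submodule.Quotient.mk_smul, Submodule.Quotient.eq, mem_monomialIdeal hU] at h1
  rw [hφB _ hmemB, smul_zero, ← Submodule.Quotient.mk_smul, eq_comm, Submodule.Quotient.mk_eq_zero,
    mem_monomialIdeal hU] at h2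
  -- If `q` represents an extension, `X_b q = 0` forces its coefficient at `w` to vanish, while `X_a
  -- q = s X_a w` forces it to be the constant term of `s`, which is `1`.
  have h3 : coeff w q = 0 := by
    by_contra hne
    exact hb (h2 (Finsupp.single b 1 + w) (by rwa [mem_support_iff, smul_eq_mul, coeff_X_mul]))
  refine ha (h1 (Finsupp.single a 1 + w) ?_)
  have h4 : s • (X a : MvPolynomial σ K) • monomial w (1 : K) - (X a : MvPolynomial σ K) • q =
      X a * (s * monomial w 1 - q) := by
    simp only [smul_eq_mul]
    ring
  have h5 : coeff w (s * monomial w (1 : K)) = 1 := by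
    have := coeff_mul_monomial 0 w (1 : K) s
    rwa [zero_add, coeff_zero_of_sub_one_mem hs, mul_one] at this
  show _ ∈ (s • (X a : MvPolynomial σ K) • monomial w (1 : K) - (X a : MvPolynomial σ K) • q).support
  rw [h4, mem_support_iff, coeff_X_mul, coeff_sub, h3, h5, sub_zero]
  exact one_ne_zero

end Obstruction

/-! ### Rerouting the product of the edges of a subtree. -/

section SpanningSubtree

variable {V : Type*} {G : SimpleGraph V}

/-- `f` is the exponent of a product of `k` edges inside `H` that can be rerouted between any two
vertices of `H`. -/
structure IsReroutable (G : SimpleGraph V) (c : V → Bool) (H : Finset V) (f : V →₀ ℕ) (k : ℕ) :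
    Prop where
  mem : f ∈ EdgeSum G k
  support : ∀ j, j ∉ H → f j = 0
  add_add : ∀ g ∈ H, ∀ h ∈ H, c g ≠ c h →
    Finsupp.single g 1 + Finsupp.single h 1 + f ∈ EdgeSum G (k + 1)
  add_sub : ∀ g ∈ H, ∀ h ∈ H, c g = c h →
    ∃ p ∈ EdgeSum G k, Finsupp.single g 1 + f = Finsupp.single h 1 + p
  sub_sub : ∀ g ∈ H, ∀ h ∈ H, c g ≠ c h →
    ∃ j, j + 1 = k ∧ ∃ p ∈ EdgeSum G j, f = Finsupp.single g 1 + Finsupp.single h 1 + p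

/-- The new vertex `h` is joined to `r ∈ H` and `f` is multiplied by that edge. Rerouting to or from
`h` reduces to rerouting to or from `r` inside `H`, with the edge `hr` used once more or once less
as needed. -/
lemma IsReroutable.insert [DecidableEq V] {c : V → Bool} (hc : ∀ u v, G.Adj u v → c u ≠ c v)
    {H : Finset V} {f : V →₀ ℕ} {k : ℕ} (hf : IsReroutable G c H f k) {r h : V} (hr : r ∈ H)
    (hrh : G.Adj h r) :
    IsReroutable G c (insert h H) (Finsupp.single h 1 + Finsupp.single r 1 + f) (k + 1) := by
  have hcr := hc h r hrh
  have opp : ∀ g, c g ≠ c h → c g = c r := fun g hg => by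
    revert hg hcr; cases c g <;> cases c h <;> cases c r <;> simp
  have addadd : ∀ g ∈ H, c g ≠ c h → Finsupp.single g 1 + Finsupp.single h 1 +
      (Finsupp.single h 1 + Finsupp.single r 1 + f) ∈ EdgeSum G (k + 1 + 1) := by
    intro g hg hgh
    obtain ⟨p, hp, e⟩ := hf.add_sub g hg r hr (opp g hgh)
    have : Finsupp.single g 1 + Finsupp.single h 1 +
        (Finsupp.single h 1 + Finsupp.single r 1 + f) =
        Finsupp.single h 1 + Finsupp.single r 1 +
          (Finsupp.single h 1 + (Finsupp.single g 1 + f)) := by abel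
    rw [this, e, ← add_assoc (Finsupp.single h 1) (Finsupp.single r 1) p]
    exact edgeSum_edge hrh (edgeSum_edge hrh hp)
  have subsub : ∀ g ∈ H, c g ≠ c h → ∃ p ∈ EdgeSum G k,
      Finsupp.single h 1 + Finsupp.single r 1 + f =
        Finsupp.single g 1 + Finsupp.single h 1 + p := by
    intro g hg hgh
    obtain ⟨p, hp, e⟩ := hf.add_sub r hr g hg (opp g hgh).symm
    refine ⟨p, hp, ?_⟩
    rw [add_assoc, e]
    abel
  refine ⟨edgeSum_edge hrh hf.mem, ?_, ?_, ?_, ?_⟩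
  · intro j hj
    rw [Finset.mem_insert, not_or] at hj
    have hrj : r ≠ j := fun h => hj.2 (h ▸ hr)
    simp [hf.support j hj.2, Ne.symm hj.1, hrj]
  · intro g hg g' hg' hgg'
    rcases Finset.mem_insert.1 hg with rfl | hgH <;>
      rcases Finset.mem_insert.1 hg' with rfl | hgH'
    · exact absurd rfl hgg'
    · rw [add_comm (Finsupp.single g 1) (Finsupp.single g' 1)]
      exact addadd g' hgH' hgg'.symm
    · exact addadd g hgH hgg'
    · rw [add_left_comm]
      exact edgeSum_edge hrh (hf.add_add g hgH g' hgH' hgg')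
  · intro g hg g' hg' hgg'
    rcases Finset.mem_insert.1 hg with rfl | hgH <;>
      rcases Finset.mem_insert.1 hg' with rfl | hgH'
    · exact ⟨_, edgeSum_edge hrh hf.mem, rfl⟩
    · obtain ⟨j, rfl, p, hp, e⟩ := hf.sub_sub g' hgH' r hr (hgg' ▸ hcr)
      refine ⟨_, edgeSum_edge hrh (edgeSum_edge hrh hp), ?_⟩
      rw [e]
      abel
    · refine ⟨_, hf.add_add g hgH r hr (hgg' ▸ hcr), ?_⟩
      abel
    · obtain ⟨p, hp, e⟩ := hf.add_sub g hgH g' hgH' hgg'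
      refine ⟨_, edgeSum_edge hrh hp, ?_⟩
      rw [add_left_comm, e]
      abel
  · intro g hg g' hg' hgg'
    rcases Finset.mem_insert.1 hg with rfl | hgH <;>
      rcases Finset.mem_insert.1 hg' with rfl | hgH'
    · exact absurd rfl hgg'
    · obtain ⟨p, hp, e⟩ := subsub g' hgH' hgg'.symm
      exact ⟨k, rfl, p, hp, by rw [e]; abel⟩
    · obtain ⟨p, hp, e⟩ := subsub g hgH hgg'
      exact ⟨k, rfl, p, hp, e⟩
    · obtain ⟨j, rfl, p, hp, e⟩ := hf.sub_sub g hgH g' hgH' hgg'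
      refine ⟨j + 1, rfl, _, edgeSum_edge hrh hp, ?_⟩
      rw [e]
      abel

/-- A subtree is grown from one vertex; by connectedness some edge leaves `H` as long as `H` is not
everything. -/
lemma exists_isReroutable [Fintype V] (hG : G.Connected) {c : V → Bool}
    (hc : ∀ u v, G.Adj u v → c u ≠ c v) (k : ℕ) (hk : k + 1 ≤ Fintype.card V) :
    ∃ (H : Finset V) (f : V →₀ ℕ), H.card = k + 1 ∧ IsReroutable G c H f k := by
  classical
  induction k with
  | zero =>
    obtain ⟨r⟩ := hG.nonempty
    refine ⟨{r}, 0, Finset.card_singleton r, rfl, fun _ _ => rfl, ?_, ?_, ?_⟩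
    · intro g hg h hh hgh
      rw [Finset.mem_singleton] at hg hh
      exact absurd rfl (hh ▸ hg ▸ hgh)
    · intro g hg h hh _
      rw [Finset.mem_singleton] at hg hh
      subst hg hh
      exact ⟨0, rfl, rfl⟩
    · intro g hg h hh hgh
      rw [Finset.mem_singleton] at hg hh
      exact absurd rfl (hh ▸ hg ▸ hgh)
  | succ k ih =>
    obtain ⟨H, f, hH, hf⟩ := ih (by omega)
    obtain ⟨x, hx⟩ := Finset.card_pos.1 (by omega : 0 < H.card)
    obtain ⟨y, hy⟩ : ∃ y, y ∉ H := by
      by_contra hcon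
      push Not at hcon
      rw [Finset.eq_univ_of_forall hcon, Finset.card_univ] at hH
      omega
    obtain ⟨p⟩ := hG.preconnected x y
    obtain ⟨e, -, he1, he2⟩ := p.exists_boundary_dart (H : Set V) hx hy
    exact ⟨insert e.snd H, _, by rw [Finset.card_insert_of_notMem he2, hH],
      hf.insert hc he1 e.adj.symm⟩

end SpanningSubtree

section EdgeSumColoring

variable {σ : Type*} {G : SimpleGraph σ}

/-- Each edge has exactly one end of each colour. -/
lemma sum_color_of_mem_edgeSum [Fintype σ] {c : σ → Bool} (hc : ∀ u v, G.Adj u v → c u ≠ c v)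
    (e : Bool) {k : ℕ} {b : σ →₀ ℕ} (hb : b ∈ EdgeSum G k) :
    ∑ z with c z = e, b z = k := by
  classical
  induction k generalizing b with
  | zero =>
    obtain rfl : b = 0 := hb
    simp
  | succ k ih =>
    obtain ⟨u, v, huv, b, hb, rfl⟩ := hb
    have h := hc u v huv
    simp only [Finsupp.add_apply, Finset.sum_add_distrib, ih hb]
    have hs : ∀ w : σ, ∑ z with c z = e, (Finsupp.single w 1 : σ →₀ ℕ) z =
        if c w = e then 1 else 0 := fun w => by
      simp [Finsupp.single_apply, Finset.sum_ite_eq]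
    rw [hs, hs]
    revert h
    cases c u <;> cases c v <;> cases e <;> simp [add_comm]

end EdgeSumColoring

/-! ### Whisker graphs and the witness monomial. -/

section Whisker

variable {V : Type*} {G : SimpleGraph V}

lemma whiskerGraph_adj_inl {u v : V} :
    (whiskerGraph G).Adj (Sum.inl u) (Sum.inl v) ↔ G.Adj u v := Iff.rfl

lemma whiskerGraph_adj_whisker (v : V) : (whiskerGraph G).Adj (Sum.inr v) (Sum.inl v) := rfl

lemma whiskerGraph_eq_of_adj_inr {v : V} {z : V ⊕ V} (h : (whiskerGraph G).Adj (Sum.inr v) z) :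
    z = Sum.inl v := by
  rcases z with z | z
  · exact congrArg Sum.inl (Eq.symm h)
  · exact h.elim

/-- Take the start of a longest path in the induced forest: by maximality its neighbours lie on the
path, and by acyclicity only the second vertex can be one. -/
lemma SimpleGraph.IsAcyclic.isOneDegenerate [Finite V] (hG : G.IsAcyclic) :
    IsOneDegenerate G := by
  rintro A ⟨a, ha⟩
  have : Nonempty (A : Set V) := ⟨⟨a, ha⟩⟩
  have hA := hG.induce (A : Set V)
  obtain ⟨u, v, p, hp, hmax⟩ :=
    SimpleGraph.Walk.exists_isPath_forall_isPath_length_le_length (G.induce (A : Set V))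
  refine ⟨u, u.2, p.snd, fun x hx hux => ?_⟩
  have hadj : (G.induce (A : Set V)).Adj u ⟨x, hx⟩ := hux
  have hlong : ¬ (p.cons hadj.symm).IsPath := fun h => by
    have := hmax _ _ _ h
    rw [SimpleGraph.Walk.length_cons] at this
    omega
  have hmem : (⟨x, hx⟩ : (A : Set V)) ∈ p.support := by
    by_contra h
    exact hlong (hp.cons h)
  exact congrArg Subtype.val (hA.eq_snd_of_adj_start hp hadj hmem)

lemma IsOneDegenerate.whiskerGraph (hG : IsOneDegenerate G) :
    IsOneDegenerate (whiskerGraph G) := by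
  classical
  intro A hA
  by_cases h : ∃ v, Sum.inr v ∈ A
  · obtain ⟨v, hv⟩ := h
    exact ⟨Sum.inr v, hv, Sum.inl v, fun x _ hx => whiskerGraph_eq_of_adj_inr hx⟩
  · push Not at h
    have hA' : ∀ x ∈ A, ∃ u, x = Sum.inl u := fun x hx => by
      rcases x with u | u
      · exact ⟨u, rfl⟩
      · exact absurd hx (h u)
    let A' : Finset V := A.preimage Sum.inl Sum.inl_injective.injOn
    obtain ⟨a, ha⟩ := hA
    obtain ⟨u, rfl⟩ := hA' a ha
    obtain ⟨v, hv, z, hz⟩ := hG A' ⟨u, Finset.mem_preimage.2 ha⟩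
    refine ⟨Sum.inl v, Finset.mem_preimage.1 hv, Sum.inl z, fun x hx hvx => ?_⟩
    obtain ⟨w, rfl⟩ := hA' x hx
    exact congrArg Sum.inl (hz w (Finset.mem_preimage.2 hx) hvx)

lemma isPacking_whiskers [Fintype V] [DecidableEq V] :
    IsPacking (whiskerGraph G) ∅ (Finset.univ.map (Function.Embedding.inr : V ↪ V ⊕ V)) := by
  refine ⟨fun _ _ => Finset.notMem_empty _, ?_, ?_⟩
  · intro s hs t ht
    obtain ⟨u, -, rfl⟩ := Finset.mem_map.1 hs
    obtain ⟨v, -, rfl⟩ := Finset.mem_map.1 ht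
    exact id
  · intro s hs t ht hst x hsx htx
    obtain ⟨u, -, rfl⟩ := Finset.mem_map.1 hs
    obtain ⟨v, -, rfl⟩ := Finset.mem_map.1 ht
    have := (whiskerGraph_eq_of_adj_inr hsx).symm.trans (whiskerGraph_eq_of_adj_inr htx)
    exact absurd (congrArg Sum.inr (Sum.inl_injective this)) hst

lemma mapDomain_mem_edgeSum {k : ℕ} {b : V →₀ ℕ} (hb : b ∈ EdgeSum G k) :
    b.mapDomain Sum.inl ∈ EdgeSum (whiskerGraph G) k := by
  induction k generalizing b with
  | zero =>
    obtain rfl : b = 0 := hb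
    exact Finsupp.mapDomain_zero
  | succ k ih =>
    obtain ⟨u, v, huv, b, hb, rfl⟩ := hb
    rw [Finsupp.mapDomain_add, Finsupp.mapDomain_add, Finsupp.mapDomain_single,
      Finsupp.mapDomain_single]
    exact edgeSum_edge (whiskerGraph_adj_inl.2 huv) (ih hb)

lemma edgeSum_whisker_le {k : ℕ} {b : V ⊕ V →₀ ℕ} (hb : b ∈ EdgeSum (whiskerGraph G) k) (v : V) :
    b (Sum.inr v) ≤ b (Sum.inl v) := by
  classical
  induction k generalizing b with
  | zero =>
    obtain rfl : b = 0 := hb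
    exact le_rfl
  | succ k ih =>
    obtain ⟨x, y, hxy, b, hb, rfl⟩ := hb
    have := ih hb
    simp only [Finsupp.add_apply, Finsupp.single_apply]
    rcases x with x | x <;> rcases y with y | y
    · simp only [reduceCtorEq, if_false]
      omega
    · obtain rfl : x = y := hxy
      simp only [reduceCtorEq, if_false, Sum.inl.injEq, Sum.inr.injEq]
      omega
    · obtain rfl : x = y := hxy
      simp only [reduceCtorEq, if_false, Sum.inl.injEq, Sum.inr.injEq]
      omega
    · exact hxy.elim

/-- The colouring of the whisker graph that extends a colouring of the graph. -/
def whiskerColor (c : V → Bool) : V ⊕ V → Bool := Sum.elim c fun v => !c v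

lemma whiskerColor_ne {c : V → Bool} (hc : ∀ u v, G.Adj u v → c u ≠ c v) (x y : V ⊕ V)
    (h : (whiskerGraph G).Adj x y) : whiskerColor c x ≠ whiskerColor c y := by
  rcases x with x | x <;> rcases y with y | y
  · exact hc x y h
  · obtain rfl : x = y := h
    simp [whiskerColor]
  · obtain rfl : x = y := h
    simp [whiskerColor]
  · exact h.elim

/-- The vertex of `G` below a vertex of the whisker graph. -/
def whiskerBase : V ⊕ V → V := Sum.elim id id

/-- Since `y_h` has the colour opposite to `x_h`, the new cases are `x_g y_h f = (x_h y_h)(x_g f /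
x_h)` and `y_g y_h f = (x_g y_g)(x_h y_h)(f / (x_g x_h))`; the quotients are products of edges by
rerouting. -/
lemma IsReroutable.add_add_mem {c : V → Bool} {H : Finset V} {f : V →₀ ℕ} {k : ℕ}
    (hf : IsReroutable G c H f k) {x y : V ⊕ V} (hx : whiskerBase x ∈ H) (hy : whiskerBase y ∈ H)
    (hxy : whiskerColor c x ≠ whiskerColor c y) :
    Finsupp.single x 1 + Finsupp.single y 1 + f.mapDomain Sum.inl ∈
      EdgeSum (whiskerGraph G) (k + 1) := by
  have mixed : ∀ g ∈ H, ∀ h ∈ H, c g = c h →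
      Finsupp.single (Sum.inl g) 1 + Finsupp.single (Sum.inr h) 1 + f.mapDomain Sum.inl ∈
        EdgeSum (whiskerGraph G) (k + 1) := by
    intro g hg h hh hgh
    obtain ⟨p, hp, e⟩ := hf.add_sub g hg h hh hgh
    have e' := congrArg (Finsupp.mapDomain (Sum.inl : V → V ⊕ V)) e
    rw [Finsupp.mapDomain_add, Finsupp.mapDomain_add, Finsupp.mapDomain_single,
      Finsupp.mapDomain_single] at e'
    have := edgeSum_edge (whiskerGraph_adj_whisker h) (mapDomain_mem_edgeSum hp)
    rw [add_assoc, ← e'] at this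
    convert this using 1
    abel
  rcases x with g | g <;> rcases y with h | h
  · have := mapDomain_mem_edgeSum (hf.add_add g hx h hy hxy)
    rwa [Finsupp.mapDomain_add, Finsupp.mapDomain_add, Finsupp.mapDomain_single,
      Finsupp.mapDomain_single] at this
  · refine mixed g hx h hy ?_
    revert hxy
    simp only [whiskerColor, Sum.elim_inl, Sum.elim_inr]
    cases c g <;> cases c h <;> simp
  · rw [add_comm (Finsupp.single (Sum.inr g) 1)]
    refine mixed h hy g hx ?_
    revert hxy
    simp only [whiskerColor, Sum.elim_inl, Sum.elim_inr]
    cases c g <;> cases c h <;> simp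
  · have hgh : c g ≠ c h := fun h => hxy (by simp [whiskerColor, h])
    obtain ⟨j, rfl, p, hp, e⟩ := hf.sub_sub g hx h hy hgh
    rw [e, Finsupp.mapDomain_add, Finsupp.mapDomain_add, Finsupp.mapDomain_single,
      Finsupp.mapDomain_single]
    convert edgeSum_edge (whiskerGraph_adj_whisker g) (edgeSum_edge (whiskerGraph_adj_whisker h)
      (mapDomain_mem_edgeSum hp)) using 1
    abel

/-- The socle-like exponent: `f` together with the whiskers outside `H`. -/
noncomputable def whiskerExponent [Fintype V] [DecidableEq V] (H : Finset V) (f : V →₀ ℕ) :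
    V ⊕ V →₀ ℕ :=
  f.mapDomain Sum.inl + ∑ j ∈ Hᶜ, Finsupp.single (Sum.inr j) 1

section Exponent

variable [Fintype V] [DecidableEq V]

lemma whiskerExponent_inl (H : Finset V) (f : V →₀ ℕ) (v : V) :
    whiskerExponent H f (Sum.inl v) = f v := by
  simp [whiskerExponent, Finsupp.mapDomain_apply Sum.inl_injective]

lemma whiskerExponent_inr (H : Finset V) (f : V →₀ ℕ) (v : V) :
    whiskerExponent H f (Sum.inr v) = if v ∈ H then 0 else 1 := by
  have h : f.mapDomain (Sum.inl : V → V ⊕ V) (Sum.inr v) = 0 :=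
    Finsupp.mapDomain_of_notMem_range _ _ (by simp)
  simp only [whiskerExponent, Finsupp.add_apply, h, zero_add, Finsupp.finsetSum_apply,
    Finsupp.single_apply, Sum.inr.injEq, Finset.sum_ite_eq', Finset.mem_compl]
  by_cases hv : v ∈ H <;> simp [hv]

/-- A product of `k + 1` edges dividing this monomial cannot use `y_j` for `j ∉ H`, since `x_j` is
absent. Its part of the colour opposite to `x` then divides that part of `f`, which has degree only
`k`. -/
lemma IsReroutable.single_add_notMem {c : V → Bool} (hc : ∀ u v, G.Adj u v → c u ≠ c v)
    {H : Finset V} {f : V →₀ ℕ} {k : ℕ}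
    (hf : IsReroutable G c H f k) {x : V ⊕ V} (hx : whiskerBase x ∈ H) :
    Finsupp.single x 1 + whiskerExponent H f ∉ killedExponents (whiskerGraph G) ∅ (k + 1) := by
  rintro (⟨w, hw, -⟩ | ⟨b, hb, hle⟩)
  · simp at hw
  have hoff : ∀ j, j ∉ H → x ≠ Sum.inl j ∧ x ≠ Sum.inr j := fun j hj =>
    ⟨fun h => hj (by rw [h] at hx; exact hx), fun h => hj (by rw [h] at hx; exact hx)⟩
  have hb0 : ∀ j, j ∉ H → b (Sum.inr j) = 0 := fun j hj => by
    have h1 := hle (Sum.inl j)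
    rw [Finsupp.add_apply, whiskerExponent_inl, hf.support j hj,
      Finsupp.single_eq_of_ne' (hoff j hj).1] at h1
    have := edgeSum_whisker_le hb j
    omega
  have hbx : ∀ z, whiskerColor c z = !whiskerColor c x → b z ≤ f.mapDomain Sum.inl z := by
    intro z hz
    have hxz : x ≠ z := fun h => by simp [h] at hz
    have h1 := hle z
    rw [Finsupp.add_apply, Finsupp.single_eq_of_ne' hxz, zero_add] at h1
    rcases z with j | j
    · rwa [whiskerExponent_inl, ← Finsupp.mapDomain_apply Sum.inl_injective f] at h1
    · by_cases hj : j ∈ H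
      · rw [whiskerExponent_inr, if_pos hj] at h1
        omega
      · rw [hb0 j hj]
        exact Nat.zero_le _
  have hcol := whiskerColor_ne hc
  have h1 := sum_color_of_mem_edgeSum hcol (!whiskerColor c x) hb
  have h2 := sum_color_of_mem_edgeSum hcol (!whiskerColor c x) (mapDomain_mem_edgeSum hf.mem)
  have h3 : ∑ z with whiskerColor c z = !whiskerColor c x, b z ≤
      ∑ z with whiskerColor c z = !whiskerColor c x, f.mapDomain Sum.inl z :=
    Finset.sum_le_sum fun z hz => hbx z (Finset.mem_filter.1 hz).2
  omega

/-- The vertices of `G` outside `H`, and the vertices of colour `e` on or above `H`. -/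
def colorSide (c : V → Bool) (H : Finset V) (e : Bool) : Finset (V ⊕ V) :=
  {x | (∃ j, j ∉ H ∧ x = Sum.inl j) ∨ (whiskerBase x ∈ H ∧ whiskerColor c x = e)}

lemma mem_colorSide {c : V → Bool} {H : Finset V} {e : Bool} {x : V ⊕ V} :
    x ∈ colorSide c H e ↔
      (∃ j, j ∉ H ∧ x = Sum.inl j) ∨ (whiskerBase x ∈ H ∧ whiskerColor c x = e) := by
  simp [colorSide]

/-- Only the whisker leaves outside `H` are missing, so their number is the dimension of the
quotient by the sum of the two ideals of variables. -/
lemma card_colorSide_union (c : V → Bool) (H : Finset V) :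
    (colorSide c H true ∪ colorSide c H false).card + (Fintype.card V - H.card) =
      Fintype.card (V ⊕ V) := by
  have h : (colorSide c H true ∪ colorSide c H false)ᶜ = Hᶜ.map Function.Embedding.inr := by
    ext x
    rw [Finset.mem_compl, Finset.mem_union, mem_colorSide, mem_colorSide, Finset.mem_map]
    rcases x with j | j <;> by_cases hj : j ∈ H <;> cases hcj : c j <;>
      simp [whiskerBase, whiskerColor, hj, hcj]
  have h1 := congrArg Finset.card h
  rw [Finset.card_map, Finset.card_compl, Finset.card_compl] at h1
  have := Finset.card_le_univ (colorSide c H true ∪ colorSide c H false)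
  omega

lemma IsReroutable.add_mem {c : V → Bool}
    {H : Finset V} {f : V →₀ ℕ} {k : ℕ} (hf : IsReroutable G c H f k) (m : V ⊕ V →₀ ℕ)
    (hA : ∃ a ∈ colorSide c H true, m a ≠ 0) (hB : ∃ b ∈ colorSide c H false, m b ≠ 0) :
    m + whiskerExponent H f ∈ killedExponents (whiskerGraph G) ∅ (k + 1) := by
  -- For `j ∉ H` the factor `y_j` of the exponent completes `x_j` to a whisker, the extra edge next
  -- to `f`.
  have outside : ∀ j, j ∉ H → m (Sum.inl j) ≠ 0 →
      m + whiskerExponent H f ∈ killedExponents (whiskerGraph G) ∅ (k + 1) := by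
    intro j hj hm
    refine Or.inr ⟨_, edgeSum_edge (whiskerGraph_adj_whisker j) (mapDomain_mem_edgeSum hf.mem), ?_⟩
    have h1 : Finsupp.single (Sum.inl j) 1 ≤ m := by
      rw [Finsupp.single_le_iff]
      omega
    have h2 : (Finsupp.single (Sum.inr j) 1 : V ⊕ V →₀ ℕ) ≤
        ∑ j ∈ Hᶜ, Finsupp.single (Sum.inr j) 1 :=
      Finset.single_le_sum (f := fun j => (Finsupp.single (Sum.inr j) 1 : V ⊕ V →₀ ℕ))
        (fun _ _ => zero_le) (Finset.mem_compl.2 hj)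
    calc _ = Finsupp.single (Sum.inl j) 1 + (f.mapDomain Sum.inl +
          (Finsupp.single (Sum.inr j) 1 : V ⊕ V →₀ ℕ)) := by abel
      _ ≤ _ := add_le_add h1 (add_le_add_right h2 _)
  obtain ⟨a, ha, hma⟩ := hA
  obtain ⟨b, hb, hmb⟩ := hB
  rcases mem_colorSide.1 ha with ⟨j, hj, rfl⟩ | ⟨haH, hca⟩
  · exact outside j hj hma
  rcases mem_colorSide.1 hb with ⟨j, hj, rfl⟩ | ⟨hbH, hcb⟩
  · exact outside j hj hmb
  have hab : whiskerColor c a ≠ whiskerColor c b := by simp [hca, hcb]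
  have hne : a ≠ b := fun h => hab (congrArg _ h)
  refine Or.inr ⟨_, hf.add_add_mem haH hbH hab, add_le_add (fun z => ?_) le_self_add⟩
  rw [Finsupp.add_apply]
  by_cases hza : a = z
  · subst hza
    rw [Finsupp.single_eq_same, Finsupp.single_eq_of_ne' hne.symm]
    omega
  · rw [Finsupp.single_eq_of_ne' hza, zero_add]
    by_cases hzb : b = z
    · subst hzb
      rw [Finsupp.single_eq_same]
      omega
    · rw [Finsupp.single_eq_of_ne' hzb]
      exact Nat.zero_le _

end Exponent

end Whisker

/-! ### The upper bound and the conclusion. -/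

section Depth

lemma edgeIdeal_pow_le_idealOfVars (K : Type*) [Field K] {σ : Type*} (G : SimpleGraph σ) {k : ℕ}
    (hk : 1 ≤ k) : edgeIdeal K G ^ k ≤ idealOfVars σ K := by
  refine (Ideal.pow_le_self (by omega)).trans (Ideal.span_le.2 ?_)
  rintro _ ⟨u, v, -, rfl⟩
  exact Ideal.mul_mem_right _ _ (X_mem_idealOfVars u)

lemma SimpleGraph.IsTree.le_of_extVanishesBelow (K : Type*) [Field K] {V : Type*} [Fintype V]
    {G : SimpleGraph V} (hG : G.IsTree) {k : ℕ} (hkn : k + 1 ≤ Fintype.card V) {d : ℕ}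
    (h : ExtVanishesBelow (idealOfVars (V ⊕ V) K)
      (MvPolynomial (V ⊕ V) K ⧸ edgeIdeal K (whiskerGraph G) ^ (k + 1)) d) :
    d ≤ Fintype.card V - (k + 1) + 1 := by
  classical
  by_contra hd
  obtain ⟨C⟩ := hG.colorable_two
  let c : V → Bool := fun v => decide (C v = 0)
  have hc : ∀ u v, G.Adj u v → c u ≠ c v := by
    intro u v huv
    have := C.valid huv
    simp only [c]
    generalize C u = a at *
    generalize C v = b at *
    revert a b
    decide
  obtain ⟨H, f, hH, hf⟩ := exists_isReroutable hG.connected hc k hkn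
  rw [edgeIdeal_pow_eq] at h
  have hcard := card_colorSide_union c H
  rw [hH] at hcard
  -- There are `n - (k + 1)` missing variables, so `Ext^1` is reached exactly when `d` exceeds the
  -- claimed depth.
  have hk := h.killed _ 1 _ hcard (by omega)
  obtain ⟨g, hg⟩ := Finset.card_pos.1 (by omega : 0 < H.card)
  -- Both colours occur above a single `g ∈ H`, on `x_g` and on `y_g`, even when `H` has one
  -- element.
  have hside : ∀ e, ∃ x ∈ colorSide c H e, Finsupp.single x 1 + whiskerExponent H f ∉
      killedExponents (whiskerGraph G) ∅ (k + 1) := by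
    intro e
    by_cases he : c g = e
    · exact ⟨Sum.inl g, mem_colorSide.2 (Or.inr ⟨hg, he⟩), hf.single_add_notMem hc hg⟩
    · exact ⟨Sum.inr g, mem_colorSide.2 (Or.inr ⟨hg, by
        revert he; simp only [whiskerColor, Sum.elim_inr]; cases c g <;> cases e <;> simp⟩),
        hf.single_add_notMem hc hg⟩
  exact not_killed_ext_one (isUpperSet_killedExponents ∅ (k + 1)) hf.add_mem (hside true)
    (hside false) hk

end Depth

theorem corollary2p6 (K : Type*) [Field K] {V : Type*} [Fintype V] (G : SimpleGraph V)
    (hG : G.IsTree) (k : ℕ) (hk : 1 ≤ k) (hkn : k ≤ Fintype.card V) :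
    depthAt (MvPolynomial.idealOfVars (V ⊕ V) K)
        (MvPolynomial (V ⊕ V) K ⧸ edgeIdeal K (whiskerGraph G) ^ k) =
      ((Fintype.card V - k + 1 : ℕ) : ℕ∞) := by
  classical
  have hI : idealOfVars (V ⊕ V) K ≠ ⊤ := fun h =>
    one_notMem_idealOfVars ((Ideal.eq_top_iff_one _).1 h)
  have hJ := edgeIdeal_pow_le_idealOfVars K (whiskerGraph G) hk
  apply le_antisymm
  · refine sSup_le ?_
    rintro _ ⟨rs, hrs, hreg, rfl⟩
    obtain ⟨k, rfl⟩ : ∃ j, k = j + 1 := ⟨k - 1, by omega⟩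
    exact_mod_cast hG.le_of_extVanishesBelow K hkn (extVanishesBelow_of_isRegular hI hJ hrs hreg)
  · have h : ExtVanishesBelow (idealOfVars (V ⊕ V) K)
        (MvPolynomial (V ⊕ V) K ⧸ edgeIdeal K (whiskerGraph G) ^ k) (Fintype.card V - k + 1) := by
      rw [edgeIdeal_pow_eq]
      refine isPacking_whiskers.extVanishesBelow hG.isAcyclic.isOneDegenerate.whiskerGraph k ?_
      rw [Finset.card_map, Finset.card_univ]
      omega
    obtain ⟨rs, hlen, hrs, hreg⟩ := exists_isRegular_of_extVanishesBelow hI hJ h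
    exact le_sSup ⟨rs, hrs, hreg, by rw [hlen]⟩
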